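/- For a finite simple graph $G$ with vertex set $V$, let $S(G)$ be the set of all real symmetric matrices $A=(a_{ij})_{i,j\in V}$ such that, for all $i\ne j$, $a_{ij}\neq 0$ if and only if $ij$ is an edge of $G$ (the diagonal entries are arbitrary). Let $q(A)$ be the number of distinct eigenvalues of $A$, and let $q(G)=\min\{q(A): A\in S(G)\}$. For a binary sequence $(b_1,\dots,b_n)$, the threshold graph with creation sequence $(b_1,\dots,b_n)$ is the graph with vertices $v_1,\dots,v_n$ in which, for $i<j$, $v_i$ and $v_j$ are adjacent if and only if $b_j=1$; write $G\cong(b_1,\dots,b_n)$ if $G$ is isomorphic to this graph. Theorem. Let $k_1\ge 1$ and $k_2\ge 0$ be integers, and let $G\cong(\underbrace{0,\dots,0}_{k_1},1,\underbrace{0,\dots,0}_{k_2},1)$ be a threshold graph of order $n=k_1+k_2+2\ge 5$. Then $$q(G)=\begin{cases}3 & \text{if } k_1\in\{1,2\}\text{ or }k_2\in\{0,1\},\\ 4 & \text{otherwise.}\end{cases}$$ -/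

import Mathlib

/-- The threshold graph with creation sequence `b` (`false` is the character 0, `true` is the
character 1): the vertices are the positions of `b`, added in order, and the later of two distinct
vertices is adjacent to the earlier one iff it was added as a dominating vertex. -/
def thresholdGraph (b : List Bool) : SimpleGraph (Fin b.length) where
  Adj i j := i ≠ j ∧ b.get (max i j) = true
  symm := ⟨fun i j h => ⟨h.1.symm, by rw [max_comm]; exact h.2⟩⟩
  loopless := ⟨fun _ h => h.1 rfl⟩

/-- The creation sequence `(0, …, 0, 1, 0, …, 0, 1)` with blocks of `k₁` and `k₂` zeros. -/
def traceTwoSequence (k₁ k₂ : ℕ) : List Bool :=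
  List.replicate k₁ false ++ [true] ++ List.replicate k₂ false ++ [true]

/-- `S(G)`: the real symmetric matrices whose off-diagonal entry at `(i, j)` is nonzero iff `i` and
`j` are adjacent in `G`; the diagonal is unrestricted. -/
def symmetricMatricesOf {V : Type*} (G : SimpleGraph V) : Set (Matrix V V ℝ) :=
  {A | A.IsSymm ∧ ∀ i j, i ≠ j → (A i j ≠ 0 ↔ G.Adj i j)}

/-- `q(A)`: the number of distinct (real) eigenvalues of a square matrix. -/
noncomputable def numDistinctEigenvalues {V : Type*} [Fintype V] (A : Matrix V V ℝ) : ℕ :=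
  {μ : ℝ | Module.End.HasEigenvalue A.mulVecLin μ}.ncard

/-- `q(G)`: the minimum number of distinct eigenvalues over all matrices in `S(G)`. -/
noncomputable def minDistinctEigenvalues {V : Type*} [Fintype V] (G : SimpleGraph V) : ℕ :=
  sInf (numDistinctEigenvalues '' symmetricMatricesOf G)

/-- The set of eigenvalues is finite, so its `ncard` is its true cardinality. -/
theorem finite_eigenvalues {V : Type*} [Fintype V] (A : Matrix V V ℝ) :
    {μ : ℝ | Module.End.HasEigenvalue A.mulVecLin μ}.Finite :=
  Module.End.finite_hasEigenvalue A.mulVecLin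

/-- `q(G)` is a minimum, not merely an infimum. -/
theorem minDistinctEigenvalues_isLeast {V : Type*} [Fintype V] (G : SimpleGraph V) :
    IsLeast (numDistinctEigenvalues '' symmetricMatricesOf G) (minDistinctEigenvalues G) := by
  classical
  refine ⟨Nat.sInf_mem (Set.Nonempty.image _ ⟨G.adjMatrix ℝ, G.isSymm_adjMatrix, ?_⟩),
    fun _ h => Nat.sInf_le h⟩
  intro i j _
  simp [SimpleGraph.adjMatrix_apply]

/-!
The graph `(0, …, 0, 1, 0, …, 0, 1)` consists of a star with centre `u` and a set `α` of leaves,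
a set `β` of isolated vertices, and a vertex `w` joined to everything. A matrix in `S(G)` is
determined by its diagonal and by nonzero weights on the edges `αu`, `αw`, `βw`, `uw`. Since it is
symmetric, it has at most `m` distinct eigenvalues exactly when some real monic polynomial of degree
`m` annihilates it.

*Lower bounds.* A quadratic relation `A² = c₁ A + c₀` fails: if `β` is nonempty, there is a unique
path of length two from a leaf in `β` to `u`, and no edge between them; if `|α| ≥ 3`, the weight
vectors of three members of `α` would be pairwise orthogonal in the plane with nonzero coordinates.
A cubic relation `A³ = c₂ A² + c₁ A + c₀` fails when `|α| ≥ 3` and `|β| ≥ 2`. After a shift by a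
scalar matrix some vertex of `β` has diagonal entry `0`. The entries in the rows of `β` then give
`c₂ = A w w` and express `c₁` as a sum of squares of nonzero weights, so `c₁ > 0`. The entries
between members of `α` give `e i + e j + A u u = A w w` for the diagonal entries `e` of `α`, which
forces `e` to be constant as `|α| ≥ 3`; the entries between `α` and `u` then show that `c₁` is minus
a sum of squares (`four_le_minDistinctEigenvalues_leafedConeGraph`).

*Upper bounds.* If the weights and diagonal entries are constant on `α` and on `β`, with values `e`
and `d` on the diagonal, then an eigenvector is constant on `α` unless its eigenvalue is `e`, and
constant on `β` unless it is `d`; all other eigenvalues are those of a quotient of size four. With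
suitable weights `e` and `d` are eigenvalues of the quotient, for a total of four. When `α` or `β`
is a singleton, one of `e`, `d` need not occur and the quotient can be given a double eigenvalue;
when `β` is empty, the quotient has size three, and `e` can be one of its eigenvalues; when `|α| = 2`,
opposite diagonal entries on `α` give a matrix with `A³ = 12 A`.
-/

open Polynomial Matrix

/-! ### Eigenvalues of symmetric matrices with a given graph -/

theorem hasEigenvalue_mulVecLin_iff_isRoot_charpoly {V : Type*} [Fintype V] [DecidableEq V]
    (A : Matrix V V ℝ) (μ : ℝ) :
    Module.End.HasEigenvalue A.mulVecLin μ ↔ A.charpoly.IsRoot μ := by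
  rw [Module.End.hasEigenvalue_iff_isRoot_charpoly, Matrix.charpoly_mulVecLin]

theorem numDistinctEigenvalues_submatrix {V W : Type*} [Fintype V] [Fintype W]
    (A : Matrix W W ℝ) (e : V ≃ W) :
    numDistinctEigenvalues (A.submatrix e e) = numDistinctEigenvalues A := by
  classical
  simp only [numDistinctEigenvalues, hasEigenvalue_mulVecLin_iff_isRoot_charpoly]
  have h : (A.submatrix e e).charpoly = A.charpoly := A.charpoly_reindex e.symm
  rw [h]

theorem minDistinctEigenvalues_le_of_iso {V W : Type*} [Fintype V] [Fintype W]
    {G : SimpleGraph V} {H : SimpleGraph W} (f : G ≃g H) :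
    minDistinctEigenvalues G ≤ minDistinctEigenvalues H := by
  obtain ⟨A, hA, hq⟩ := (minDistinctEigenvalues_isLeast H).1
  rw [← hq, ← numDistinctEigenvalues_submatrix A f.toEquiv]
  refine (minDistinctEigenvalues_isLeast G).2 ⟨_, ⟨hA.1.submatrix _, fun i j hij => ?_⟩, rfl⟩
  rw [← f.map_adj_iff]
  exact hA.2 (f i) (f j) (f.injective.ne hij)

theorem minDistinctEigenvalues_congr {V W : Type*} [Fintype V] [Fintype W]
    {G : SimpleGraph V} {H : SimpleGraph W} (f : G ≃g H) :
    minDistinctEigenvalues G = minDistinctEigenvalues H :=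
  (minDistinctEigenvalues_le_of_iso f).antisymm (minDistinctEigenvalues_le_of_iso f.symm)

/-- To bound `q(G)` by `|S|` it suffices to give a matrix in `S(G)` with all eigenvalues in `S`. -/
theorem minDistinctEigenvalues_le {V : Type*} [Fintype V] {G : SimpleGraph V} {A : Matrix V V ℝ}
    (hA : A ∈ symmetricMatricesOf G) (S : Finset ℝ)
    (hS : ∀ (μ : ℝ) (v : V → ℝ), A *ᵥ v = μ • v → μ ∉ S → v = 0) :
    minDistinctEigenvalues G ≤ S.card := by
  refine ((minDistinctEigenvalues_isLeast G).2 ⟨A, hA, rfl⟩).trans ?_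
  rw [← Set.ncard_coe_finset]
  refine Set.ncard_le_ncard (fun μ hμ => ?_) S.finite_toSet
  obtain ⟨v, hv⟩ := Module.End.HasEigenvalue.exists_hasEigenvector hμ
  by_contra hmem
  exact hv.2 (hS μ v hv.apply_eq_smul hmem)

/-- A real symmetric matrix with at most `m` distinct eigenvalues satisfies a monic polynomial of
degree exactly `m`, and so does every translate of it by a scalar matrix. -/
theorem exists_monic_aeval_sub_smul_one_eq_zero {V : Type*} [Fintype V] [DecidableEq V]
    {A : Matrix V V ℝ} (hA : A.IsSymm) {m : ℕ} (hm : numDistinctEigenvalues A ≤ m) (d : ℝ) :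
    ∃ p : ℝ[X], p.Monic ∧ p.natDegree = m ∧ aeval (A - d • (1 : Matrix V V ℝ)) p = 0 := by
  have hH : A.IsHermitian := hA
  set S := (finite_eigenvalues A).toFinset with hS
  have hcard : S.card ≤ m := by
    rwa [numDistinctEigenvalues, Set.ncard_eq_toFinset_card _ (finite_eigenvalues A)] at hm
  -- The minimal polynomial may have degree less than `m`; a power of `X` makes up the difference.
  set r : ℝ[X] := (∏ μ ∈ S, (X - C μ)) * X ^ (m - S.card) with hr
  have hrm : r.Monic := (monic_prod_of_monic _ _ fun μ _ => monic_X_sub_C μ).mul (monic_X_pow _)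
  have hrd : r.natDegree = m := by
    rw [hr, (monic_prod_of_monic _ _ fun μ _ => monic_X_sub_C μ).natDegree_mul (monic_X_pow _),
      natDegree_prod_of_monic _ _ fun μ _ => monic_X_sub_C μ]
    simp
    omega
  have hr0 : aeval A r = 0 := by
    have hsa : IsSelfAdjoint A := hH
    -- By the functional calculus `r(A)` depends only on the values of `r` on the spectrum.
    rw [← cfc_polynomial (p := IsSelfAdjoint) r A hsa]
    have hzero : (spectrum ℝ A).EqOn (fun x => r.eval x) (fun _ => 0) := by
      intro μ hμ
      have hmem : μ ∈ S := by
        rw [← Matrix.spectrum_toLin', ← Module.End.hasEigenvalue_iff_mem_spectrum] at hμ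
        exact (finite_eigenvalues A).mem_toFinset.2 hμ
      simp only [hr, eval_mul, eval_prod]
      rw [Finset.prod_eq_zero hmem (by simp), zero_mul]
    rw [cfc_congr hzero, cfc_const_zero]
  refine ⟨r.comp (X + C d), hrm.comp_X_add_C d, ?_, ?_⟩
  · rw [natDegree_comp, natDegree_X_add_C, mul_one, hrd]
  · rw [aeval_comp]
    simpa [Algebra.algebraMap_eq_smul_one] using hr0

/-! ### The threshold graph as a cone and its matrices -/

/-- The cone over the disjoint union of a star with leaf set `α` and of isolated vertices `β`.
The vertex `.inr none` is the apex `w` of the cone and `.inl none` is the centre `u` of the star,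
so that `Option α ⊕ Option β` lists the vertices in the order of the creation sequence. -/
def leafedConeGraph (α β : Type*) : SimpleGraph (Option α ⊕ Option β) where
  Adj
    | .inr none, .inr none => False
    | .inr none, _ => True
    | _, .inr none => True
    | .inl (some _), .inl none => True
    | .inl none, .inl (some _) => True
    | _, _ => False
  symm := ⟨by rintro ((_ | _) | (_ | _)) ((_ | _) | (_ | _)) <;> simp⟩
  loopless := ⟨by rintro ((_ | _) | (_ | _)) <;> simp⟩

theorem length_traceTwoSequence (k₁ k₂ : ℕ) :
    (traceTwoSequence k₁ k₂).length = (k₁ + 1) + (k₂ + 1) := by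
  simp [traceTwoSequence]
  omega

theorem getElem_traceTwoSequence_eq_true_iff {k₁ k₂ i : ℕ}
    (h : i < (traceTwoSequence k₁ k₂).length) :
    (traceTwoSequence k₁ k₂)[i] = true ↔ i = k₁ ∨ i = k₁ + 1 + k₂ := by
  have h' := h
  rw [length_traceTwoSequence] at h'
  simp only [traceTwoSequence, List.getElem_append, List.length_append, List.length_replicate,
    List.length_singleton, List.getElem_replicate, List.getElem_singleton]
  split_ifs <;> simp <;> omega

/-- The bijection from the vertices of `leafedConeGraph` to the positions of the creation sequence;
`none` is the last vertex of each of the two blocks. -/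
def leafedConeEquiv (k₁ k₂ : ℕ) :
    Option (Fin k₁) ⊕ Option (Fin k₂) ≃ Fin (traceTwoSequence k₁ k₂).length :=
  ((finSuccEquivLast.symm.sumCongr finSuccEquivLast.symm).trans finSumFinEquiv).trans
    (finCongr (length_traceTwoSequence k₁ k₂).symm)

theorem leafedConeEquiv_adj (k₁ k₂ : ℕ) (a b : Option (Fin k₁) ⊕ Option (Fin k₂)) :
    (thresholdGraph (traceTwoSequence k₁ k₂)).Adj (leafedConeEquiv k₁ k₂ a)
      (leafedConeEquiv k₁ k₂ b) ↔ (leafedConeGraph (Fin k₁) (Fin k₂)).Adj a b := by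
  simp only [thresholdGraph, ne_eq, EmbeddingLike.apply_eq_iff_eq, List.get_eq_getElem,
    getElem_traceTwoSequence_eq_true_iff, Fin.coe_max]
  rcases a with (_ | i) | (_ | i) <;> rcases b with (_ | j) | (_ | j) <;>
    simp [leafedConeEquiv, leafedConeGraph] <;> omega

/-- `leafedConeGraph` is the threshold graph of the sequence `(0, …, 0, 1, 0, …, 0, 1)`. -/
def leafedConeIso (k₁ k₂ : ℕ) :
    leafedConeGraph (Fin k₁) (Fin k₂) ≃g thresholdGraph (traceTwoSequence k₁ k₂) :=
  ⟨leafedConeEquiv k₁ k₂, leafedConeEquiv_adj k₁ k₂ _ _⟩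

section
variable {α β : Type*} [DecidableEq α] [DecidableEq β]

/-- The symmetric matrix of the pattern of `leafedConeGraph α β` with diagonal entries `e` on `α`, `d`
on `β`, `U` at `u` and `W` at `w`, and with weights `x` on the edges `αu`, `y` on the edges `αw`, `p`
on the edges `βw` and `z` on the edge `uw`. -/
def leafedConeMatrix (e x y : α → ℝ) (d p : β → ℝ) (U W z : ℝ) :
    Matrix (Option α ⊕ Option β) (Option α ⊕ Option β) ℝ :=
  .of fun
    | .inl (some i), .inl (some j) => if i = j then e i else 0
    | .inl (some i), .inl none => x i
    | .inl none, .inl (some i) => x i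
    | .inl (some i), .inr none => y i
    | .inr none, .inl (some i) => y i
    | .inr (some i), .inr (some j) => if i = j then d i else 0
    | .inr (some i), .inr none => p i
    | .inr none, .inr (some i) => p i
    | .inl none, .inl none => U
    | .inr none, .inr none => W
    | .inl none, .inr none => z
    | .inr none, .inl none => z
    | _, _ => 0

theorem leafedConeMatrix_mem {e x y : α → ℝ} {d p : β → ℝ} {U W z : ℝ} (hx : ∀ i, x i ≠ 0)
    (hy : ∀ i, y i ≠ 0) (hp : ∀ i, p i ≠ 0) (hz : z ≠ 0) :
    leafedConeMatrix e x y d p U W z ∈ symmetricMatricesOf (leafedConeGraph α β) := by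
  constructor
  · ext ((_ | i) | (_ | i)) ((_ | j) | (_ | j)) <;> simp [leafedConeMatrix, Matrix.transpose_apply]
    all_goals
      rcases eq_or_ne i j with rfl | h
      · rfl
      · simp [h, h.symm]
  · rintro ((_ | i) | (_ | i)) ((_ | j) | (_ | j)) <;>
      simp +contextual [leafedConeMatrix, leafedConeGraph, hx, hy, hp, hz]

theorem exists_eq_leafedConeMatrix
    {A : Matrix (Option α ⊕ Option β) (Option α ⊕ Option β) ℝ}
    (hA : A ∈ symmetricMatricesOf (leafedConeGraph α β)) :
    ∃ (e x y : α → ℝ) (d p : β → ℝ) (U W z : ℝ), (∀ i, x i ≠ 0) ∧ (∀ i, y i ≠ 0) ∧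
      (∀ i, p i ≠ 0) ∧ z ≠ 0 ∧ A = leafedConeMatrix e x y d p U W z := by
  obtain ⟨hs, hA⟩ := hA
  have hs' := fun i j => (hs.apply i j)
  have hA0 : ∀ i j, i ≠ j → ¬ (leafedConeGraph α β).Adj i j → A i j = 0 := fun i j hij h =>
    not_not.1 fun h' => h ((hA i j hij).1 h')
  refine ⟨fun i => A (.inl (some i)) (.inl (some i)), fun i => A (.inl (some i)) (.inl none),
    fun i => A (.inl (some i)) (.inr none), fun i => A (.inr (some i)) (.inr (some i)),
    fun i => A (.inr (some i)) (.inr none), A (.inl none) (.inl none), A (.inr none) (.inr none),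
    A (.inl none) (.inr none), fun i => ?_, fun i => ?_, fun i => ?_, ?_, ?_⟩
  iterate 4 exact (hA _ _ (by simp)).2 (by simp [leafedConeGraph])
  ext ((_ | i) | (_ | i)) ((_ | j) | (_ | j)) <;> simp only [leafedConeMatrix, Matrix.of_apply]
  all_goals first
    | done
    | exact hs' _ _
    | exact hA0 _ _ (by simp) (by simp [leafedConeGraph])
    | skip
  all_goals
    split_ifs with h
    · rw [h]
    · exact hA0 _ _ (by simpa using h) (by simp [leafedConeGraph])

variable [Fintype α] [Fintype β] (e x y : α → ℝ) (d p : β → ℝ) (U W z : ℝ)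
  (v : Option α ⊕ Option β → ℝ)

@[simp]
theorem leafedConeMatrix_mulVec_inl_some (i : α) :
    (leafedConeMatrix e x y d p U W z *ᵥ v) (.inl (some i)) =
      e i * v (.inl (some i)) + x i * v (.inl none) + y i * v (.inr none) := by
  simp [Matrix.mulVec, dotProduct, leafedConeMatrix, Fintype.sum_sum_type]
  ring

@[simp]
theorem leafedConeMatrix_mulVec_inl_none :
    (leafedConeMatrix e x y d p U W z *ᵥ v) (.inl none) =
      ∑ i, x i * v (.inl (some i)) + U * v (.inl none) + z * v (.inr none) := by
  simp [Matrix.mulVec, dotProduct, leafedConeMatrix, Fintype.sum_sum_type]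
  ring

@[simp]
theorem leafedConeMatrix_mulVec_inr_some (i : β) :
    (leafedConeMatrix e x y d p U W z *ᵥ v) (.inr (some i)) =
      d i * v (.inr (some i)) + p i * v (.inr none) := by
  simp [Matrix.mulVec, dotProduct, leafedConeMatrix, Fintype.sum_sum_type]
  ring

@[simp]
theorem leafedConeMatrix_mulVec_inr_none :
    (leafedConeMatrix e x y d p U W z *ᵥ v) (.inr none) =
      ∑ i, y i * v (.inl (some i)) + z * v (.inl none) + ∑ i, p i * v (.inr (some i)) +
        W * v (.inr none) := by
  simp [Matrix.mulVec, dotProduct, leafedConeMatrix, Fintype.sum_sum_type]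
  ring

end

/-! ### Matrices with few eigenvalues -/

section
variable {α β : Type*} [Fintype α] [Fintype β] [DecidableEq α] [DecidableEq β]

/-- Reduction of the eigenvalue equation of a matrix with constant weights on `α` and on `β` to its
quotient: `s` and `t` stand for the weighted sums of the coordinates over `α` and `β`. If `μ` differs
from the diagonal entry on a block, or the block has at most one element, the sums determine the
coordinates on that block. -/
theorem eq_zero_of_leafedConeMatrix_mulVec_eq_smul {e d p r W μ : ℝ}
    {v : Option α ⊕ Option β → ℝ} (hr : Fintype.card α * r ^ 2 = 1)
    (h : leafedConeMatrix (fun _ => e) (fun _ => r) (fun _ => r) (fun _ => d) (fun _ => p) 1 W 1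
      *ᵥ v = μ • v)
    (hα : μ ≠ e ∨ Subsingleton α) (hβ : p ≠ 0) (hβ' : μ ≠ d ∨ Subsingleton β)
    (hsys : ∀ s u t w : ℝ, μ * s = e * s + u + w → μ * u = s + u + w →
      μ * t = d * t + Fintype.card β * p ^ 2 * w → μ * w = s + u + t + W * w →
      s = 0 ∧ u = 0 ∧ t = 0 ∧ w = 0) : v = 0 := by
  have ha := fun i => congrFun h (.inl (some i))
  have hu := congrFun h (.inl none)
  have hb := fun i => congrFun h (.inr (some i))
  have hw := congrFun h (.inr none)
  simp only [leafedConeMatrix_mulVec_inl_some, leafedConeMatrix_mulVec_inl_none,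
    leafedConeMatrix_mulVec_inr_some, leafedConeMatrix_mulVec_inr_none, Pi.smul_apply,
    smul_eq_mul, ← Finset.mul_sum] at ha hu hb hw
  have hsa := Finset.sum_congr (rfl : (Finset.univ : Finset α) = _) fun i _ => ha i
  have hsb := Finset.sum_congr (rfl : (Finset.univ : Finset β) = _) fun i _ => hb i
  simp only [Finset.sum_add_distrib, ← Finset.mul_sum, Finset.sum_const, Finset.card_univ,
    nsmul_eq_mul] at hsa hsb
  have hr0 : r ≠ 0 := by rintro rfl; simp at hr
  obtain ⟨h1, h2, h3, h4⟩ := hsys (r * ∑ i, v (.inl (some i))) (v (.inl none))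
    (p * ∑ i, v (.inr (some i))) (v (.inr none))
    (by linear_combination (-r) * hsa + (v (.inl none) + v (.inr none)) * hr)
    (by linear_combination -hu) (by linear_combination (-p) * hsb) (by linear_combination -hw)
  ext ((_ | i) | (_ | i))
  · exact h2
  · rcases hα with hα | hα
    · refine (mul_eq_zero.1 ?_).resolve_left (sub_ne_zero.2 hα)
      linear_combination -ha i + r * h2 + r * h4
    · rw [Fintype.sum_subsingleton _ i] at h1
      exact (mul_eq_zero.1 h1).resolve_left hr0
  · exact h4
  · rcases hβ' with hβ' | hβ'
    · refine (mul_eq_zero.1 ?_).resolve_left (sub_ne_zero.2 hβ')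
      linear_combination -hb i + p * h4
    · rw [Fintype.sum_subsingleton _ i] at h3
      exact (mul_eq_zero.1 h3).resolve_left hβ

theorem card_mul_sqrt_div_card_sq (γ : Type*) [Fintype γ] [Nonempty γ] {c : ℝ} (hc : 0 < c) :
    Fintype.card γ * √(c / Fintype.card γ) ^ 2 = c := by
  have : (0 : ℝ) < Fintype.card γ := by exact_mod_cast Fintype.card_pos
  rw [Real.sq_sqrt (by positivity)]
  field_simp

theorem sqrt_div_card_ne_zero (γ : Type*) [Fintype γ] [Nonempty γ] {c : ℝ} (hc : 0 < c) :
    √(c / Fintype.card γ) ≠ 0 := by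
  have : (0 : ℝ) < Fintype.card γ := by exact_mod_cast Fintype.card_pos
  positivity

/-- The quotient is `!![0, 1, 1; 1, 1, 1; 1, 1, 1]`, with eigenvalues `0` and `1 ± √3`, and `0` is also
the diagonal entry on `α`. -/
theorem minDistinctEigenvalues_leafedConeGraph_le_of_isEmpty [Nonempty α] [IsEmpty β] :
    minDistinctEigenvalues (leafedConeGraph α β) ≤ 3 := by
  have hr := sqrt_div_card_ne_zero α one_pos
  have h3 : √3 ^ 2 = (3 : ℝ) := Real.sq_sqrt (by norm_num)
  refine (minDistinctEigenvalues_le (leafedConeMatrix_mem (e := fun _ => 0)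
    (d := fun _ => 0) (p := fun _ => 1) (U := 1) (W := 1) (fun _ => hr)
    (fun _ => hr) (fun _ => one_ne_zero) one_ne_zero) {0, 1 + √3, 1 - √3} fun μ v hv hμ => ?_).trans
    Finset.card_le_three
  simp only [Finset.mem_insert, Finset.mem_singleton, not_or] at hμ
  obtain ⟨h0, hμ1, hμ2⟩ := hμ
  refine eq_zero_of_leafedConeMatrix_mulVec_eq_smul (card_mul_sqrt_div_card_sq α one_pos) hv
    (.inl h0) one_ne_zero (.inl h0) fun s u t w e1 e2 e3 e4 => ?_
  obtain rfl : t = 0 := (mul_eq_zero.1 (show μ * t = 0 by simpa using e3)).resolve_left h0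
  have hs : s = 0 := by
    refine (mul_eq_zero.1 (mul_eq_zero.1 (?_ : (μ - (1 + √3)) * ((μ - (1 - √3)) * s) = 0)
      |>.resolve_left (sub_ne_zero.2 hμ1))).resolve_left (sub_ne_zero.2 hμ2)
    linear_combination (μ - 2) * e1 + e2 + e4 - s * h3
  subst hs
  have hu : u = 0 := (mul_eq_zero.1 (show μ * u = 0 by linear_combination e2 - e1)).resolve_left h0
  exact ⟨rfl, hu, rfl, by linear_combination -e1 - hu⟩

/-- The quotient system with diagonal entry `e = 1` on `α` has only the trivial solution unless `μ`
is `0` or a root of the displayed cubic, the remaining factor of its characteristic polynomial. -/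
theorem quotient_system_eq_zero {d π W μ : ℝ} (hμ : μ ≠ 0)
    (hdet : (μ - d) * ((μ - W) * (μ - 2) - 2) - π * (μ - 2) ≠ 0) (s u t w : ℝ)
    (e1 : μ * s = 1 * s + u + w) (e2 : μ * u = s + u + w) (e3 : μ * t = d * t + π * w)
    (e4 : μ * w = s + u + t + W * w) : s = 0 ∧ u = 0 ∧ t = 0 ∧ w = 0 := by
  obtain rfl : u = s := mul_left_cancel₀ hμ (by linear_combination e2 - e1)
  obtain rfl : w = (μ - 2) * u := by linear_combination -e1
  have hu : u = 0 := (mul_eq_zero.1 (?_ : _ * u = 0)).resolve_left hdet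
  · subst hu
    exact ⟨rfl, rfl, by linear_combination -e4, by ring⟩
  · linear_combination (μ - d) * e4 + e3

/-- The quotient has the simple eigenvalues `1`, the diagonal entry on `α`, and `10 / 3`, and the double
eigenvalue `0`. -/
theorem minDistinctEigenvalues_leafedConeGraph_le_of_unique_right [Nonempty α] [Unique β] :
    minDistinctEigenvalues (leafedConeGraph α β) ≤ 3 := by
  have hr := sqrt_div_card_ne_zero α one_pos
  refine (minDistinctEigenvalues_le (leafedConeMatrix_mem (e := fun _ => 1)
    (d := fun _ => 2 / 3) (p := fun _ => 2 / 3) (U := 1) (W := 5 / 3) (fun _ => hr)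
    (fun _ => hr) (fun _ => by norm_num) one_ne_zero) {0, 1, 10 / 3} fun μ v hv hμ => ?_).trans
    Finset.card_le_three
  simp only [Finset.mem_insert, Finset.mem_singleton, not_or] at hμ
  obtain ⟨h0, hμ1, hμ2⟩ := hμ
  refine eq_zero_of_leafedConeMatrix_mulVec_eq_smul (card_mul_sqrt_div_card_sq α one_pos) hv
    (.inl hμ1) (by norm_num) (.inr inferInstance) (quotient_system_eq_zero h0 ?_)
  convert mul_ne_zero h0 (mul_ne_zero (sub_ne_zero.2 hμ1) (sub_ne_zero.2 hμ2)) using 1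
  rw [Fintype.card_unique]
  ring

/-- The quotient has the simple eigenvalues `2`, the diagonal entry on `β`, and `5`, and the double
eigenvalue `0`. -/
theorem minDistinctEigenvalues_leafedConeGraph_le_of_unique_left [Unique α] [Nonempty β] :
    minDistinctEigenvalues (leafedConeGraph α β) ≤ 3 := by
  have hp := sqrt_div_card_ne_zero β four_pos
  refine (minDistinctEigenvalues_le (leafedConeMatrix_mem (e := fun _ => 1)
    (x := fun _ => 1) (y := fun _ => 1) (d := fun _ => 2) (U := 1) (W := 3)
    (fun _ => one_ne_zero) (fun _ => one_ne_zero) (fun _ => hp) one_ne_zero) {0, 2, 5}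
    fun μ v hv hμ => ?_).trans Finset.card_le_three
  simp only [Finset.mem_insert, Finset.mem_singleton, not_or] at hμ
  obtain ⟨h0, hμ1, hμ2⟩ := hμ
  refine eq_zero_of_leafedConeMatrix_mulVec_eq_smul (by simp) hv
    (.inr inferInstance) hp (.inl hμ1) (quotient_system_eq_zero h0 ?_)
  convert mul_ne_zero h0 (mul_ne_zero (sub_ne_zero.2 hμ1) (sub_ne_zero.2 hμ2)) using 1
  rw [card_mul_sqrt_div_card_sq β four_pos]
  ring

/-- The quotient has the eigenvalues `1` and `0`, the diagonal entries on `α` and on `β`, and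
`(3 ± √17) / 2`. -/
theorem minDistinctEigenvalues_leafedConeGraph_le_four [Nonempty α] [Nonempty β] :
    minDistinctEigenvalues (leafedConeGraph α β) ≤ 4 := by
  have hr := sqrt_div_card_ne_zero α one_pos
  have hp := sqrt_div_card_ne_zero β one_pos
  have h17 : √17 ^ 2 = (17 : ℝ) := Real.sq_sqrt (by norm_num)
  refine (minDistinctEigenvalues_le (leafedConeMatrix_mem (e := fun _ => 1)
    (d := fun _ => 0) (U := 1) (W := 2) (fun _ => hr) (fun _ => hr) (fun _ => hp) one_ne_zero)
    {0, 1, (3 + √17) / 2, (3 - √17) / 2} fun μ v hv hμ => ?_).trans Finset.card_le_four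
  simp only [Finset.mem_insert, Finset.mem_singleton, not_or] at hμ
  obtain ⟨h0, hμ1, hμ2, hμ3⟩ := hμ
  refine eq_zero_of_leafedConeMatrix_mulVec_eq_smul (card_mul_sqrt_div_card_sq α one_pos) hv
    (.inl hμ1) hp (.inl h0) (quotient_system_eq_zero h0 ?_)
  convert mul_ne_zero (sub_ne_zero.2 hμ1)
    (mul_ne_zero (sub_ne_zero.2 hμ2) (sub_ne_zero.2 hμ3)) using 1
  rw [card_mul_sqrt_div_card_sq β one_pos]
  linear_combination (μ - 1) / 4 * h17

/-- Two vertices in `α` with opposite diagonal entries `±2` allow the eigenvalues `0` and `±√12`,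
where equal diagonal entries would not allow three eigenvalues once `β` has two elements. -/
theorem minDistinctEigenvalues_leafedConeGraph_fin_two_le [Nonempty β] :
    minDistinctEigenvalues (leafedConeGraph (Fin 2) β) ≤ 3 := by
  have h9 : (0 : ℝ) < 9 := by norm_num
  have hp := sqrt_div_card_ne_zero β h9
  have hp' := card_mul_sqrt_div_card_sq β h9
  have h12 : √12 ^ 2 = (12 : ℝ) := Real.sq_sqrt (by norm_num)
  refine (minDistinctEigenvalues_le (leafedConeMatrix_mem (e := ![2, -2]) (x := ![-2, 2])
    (y := fun _ => 1) (d := fun _ => 0) (U := 0) (W := 0) (by simp [Fin.forall_fin_two])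
    (fun _ => one_ne_zero) (fun _ => hp) one_ne_zero) {0, √12, -√12} fun μ v hv hμ => ?_).trans
    Finset.card_le_three
  simp only [Finset.mem_insert, Finset.mem_singleton, not_or] at hμ
  obtain ⟨h0, hμ1, hμ2⟩ := hμ
  set p := √(9 / Fintype.card β)
  have ha₀ := congrFun hv (.inl (some 0))
  have ha₁ := congrFun hv (.inl (some 1))
  have hu := congrFun hv (.inl none)
  have hb := fun i => congrFun hv (.inr (some i))
  have hw := congrFun hv (.inr none)
  simp only [leafedConeMatrix_mulVec_inl_some, leafedConeMatrix_mulVec_inl_none,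
    leafedConeMatrix_mulVec_inr_some, leafedConeMatrix_mulVec_inr_none, Pi.smul_apply,
    smul_eq_mul, ← Finset.mul_sum, Fin.sum_univ_two, Matrix.cons_val_zero, Matrix.cons_val_one]
    at ha₀ ha₁ hu hb hw
  have hsb := Finset.sum_congr (rfl : (Finset.univ : Finset β) = _) fun i _ => hb i
  simp only [Finset.sum_add_distrib, ← Finset.mul_sum, Finset.sum_const, Finset.card_univ,
    nsmul_eq_mul] at hsb
  set a := v (.inl (some 0))
  set b := v (.inl (some 1))
  set u := v (.inl none)
  set w := v (.inr none)
  set t := ∑ i, v (.inr (some i))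
  have ht : μ * (p * t) = 9 * w := by linear_combination (-p) * hsb + w * hp'
  have hμ12 : μ ^ 2 - 12 ≠ 0 := by
    convert mul_ne_zero (sub_ne_zero.2 hμ1) (sub_ne_zero.2 hμ2) using 1
    linear_combination h12
  have hw0 : w = 0 := by
    refine (mul_eq_zero.1 (?_ : _ * w = 0)).resolve_left hμ12
    linear_combination -μ * hw - ha₀ - ha₁ - hu + ht
  have hu0 : u = 0 := by
    refine (mul_eq_zero.1 (?_ : _ * u = 0)).resolve_left (mul_ne_zero h0 hμ12)
    linear_combination 2 * (μ + 2) * ha₀ - 2 * (μ - 2) * ha₁ - (μ ^ 2 - 4) * hu +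
      (μ ^ 2 - 12) * hw0
  have hb0 : b = 0 := by
    linear_combination (1 / 4) * ha₀ - (1 / 4) * ha₁ - (μ - 2) / 8 * hu +
      (1 - μ * (μ - 2) / 8) * hu0 + (μ - 2) / 8 * hw0
  have ha0 : a = 0 := by linear_combination hb0 - (1 / 2) * hu - μ / 2 * hu0 + (1 / 2) * hw0
  ext ((_ | i) | (_ | i))
  · exact hu0
  · fin_cases i
    exacts [ha0, hb0]
  · exact hw0
  · refine (mul_eq_zero.1 ?_).resolve_left h0
    linear_combination -hb i + p * hw0
end

/-! ### Polynomial relations and lower bounds -/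

section
variable {V : Type*} [Fintype V] [DecidableEq V]

theorem aeval_mulVec_of_natDegree_eq_two {A : Matrix V V ℝ} {p : ℝ[X]} (hp : p.Monic)
    (hd : p.natDegree = 2) (h : aeval A p = 0) :
    ∃ c₀ c₁ : ℝ, ∀ v, A *ᵥ (A *ᵥ v) = c₁ • (A *ᵥ v) + c₀ • v := by
  have hlead : p.coeff 2 = 1 := hd ▸ hp.coeff_natDegree
  rw [aeval_eq_sum_range, hd] at h
  refine ⟨-p.coeff 0, -p.coeff 1, fun v => ?_⟩
  have := congrArg (· *ᵥ v) h
  simp only [Finset.sum_range_succ, Finset.sum_range_zero, hlead, pow_succ, pow_zero, zero_add,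
    one_mul, one_smul, Matrix.add_mulVec, Matrix.smul_mulVec, Matrix.one_mulVec,
    Matrix.zero_mulVec, ← Matrix.mulVec_mulVec] at this
  ext i
  have := congrFun this i
  simp only [Pi.add_apply, Pi.smul_apply, smul_eq_mul, Pi.zero_apply] at this ⊢
  linear_combination this

theorem aeval_mulVec_of_natDegree_eq_three {A : Matrix V V ℝ} {p : ℝ[X]} (hp : p.Monic)
    (hd : p.natDegree = 3) (h : aeval A p = 0) :
    ∃ c₀ c₁ c₂ : ℝ, ∀ v,
      A *ᵥ (A *ᵥ (A *ᵥ v)) = c₂ • (A *ᵥ (A *ᵥ v)) + c₁ • (A *ᵥ v) + c₀ • v := by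
  have hlead : p.coeff 3 = 1 := hd ▸ hp.coeff_natDegree
  rw [aeval_eq_sum_range, hd] at h
  refine ⟨-p.coeff 0, -p.coeff 1, -p.coeff 2, fun v => ?_⟩
  have := congrArg (· *ᵥ v) h
  simp only [Finset.sum_range_succ, Finset.sum_range_zero, hlead, pow_succ, pow_zero, zero_add,
    one_mul, one_smul, Matrix.add_mulVec, Matrix.smul_mulVec, Matrix.one_mulVec,
    Matrix.zero_mulVec, ← Matrix.mulVec_mulVec] at this
  ext i
  have := congrFun this i
  simp only [Pi.add_apply, Pi.smul_apply, smul_eq_mul, Pi.zero_apply] at this ⊢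
  linear_combination this
end

theorem sub_smul_one_mem_symmetricMatricesOf {V : Type*} [DecidableEq V] {G : SimpleGraph V}
    {A : Matrix V V ℝ} (hA : A ∈ symmetricMatricesOf G) (d : ℝ) :
    A - d • (1 : Matrix V V ℝ) ∈ symmetricMatricesOf G := by
  refine ⟨hA.1.sub (Matrix.isSymm_one.smul d), fun i j hij => ?_⟩
  simpa [hij] using hA.2 i j hij

section
variable {α β : Type*} [Fintype α] [Fintype β] [DecidableEq α] [DecidableEq β]

/-- No matrix of the pattern satisfies a quadratic: with a leaf in `β` the entry of `A²` between it and
`u` is nonzero while that of `A` is zero, and with three vertices in `α` their weight vectors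
`(x, y)` would be pairwise orthogonal in the plane. -/
theorem three_le_minDistinctEigenvalues_leafedConeGraph
    (h : Nonempty β ∨ 2 < Fintype.card α) :
    3 ≤ minDistinctEigenvalues (leafedConeGraph α β) := by
  by_contra! hlt
  obtain ⟨A, hA, hq⟩ := (minDistinctEigenvalues_isLeast (leafedConeGraph α β)).1
  obtain ⟨P, hP, hPd, hPA⟩ := exists_monic_aeval_sub_smul_one_eq_zero hA.1
    (hq.trans_le (Nat.le_of_lt_succ hlt)) 0
  obtain ⟨e, x, y, d, p, U, W, z, hx, hy, hp, hz, rfl⟩ := exists_eq_leafedConeMatrix hA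
  rw [zero_smul, sub_zero] at hPA
  obtain ⟨c₀, c₁, hrel⟩ := aeval_mulVec_of_natDegree_eq_two hP hPd hPA
  rcases h with ⟨⟨b⟩⟩ | h
  · have := congrFun (hrel (Pi.single (.inr (some b)) 1)) (.inl none)
    simp only [leafedConeMatrix_mulVec_inl_some, leafedConeMatrix_mulVec_inl_none,
      leafedConeMatrix_mulVec_inr_none, Pi.add_apply, Pi.smul_apply, smul_eq_mul,
      Pi.single_apply] at this
    simp [hz, hp] at this
  · obtain ⟨i, j, k, hij, hik, hjk⟩ := Fintype.two_lt_card_iff.1 h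
    have horth : ∀ i j, i ≠ j → x i * x j + y i * y j = 0 := fun i j hij => by
      have := congrFun (hrel (Pi.single (.inl (some j)) 1)) (.inl (some i))
      simp only [leafedConeMatrix_mulVec_inl_some, leafedConeMatrix_mulVec_inl_none,
      leafedConeMatrix_mulVec_inr_none, Pi.add_apply, Pi.smul_apply, smul_eq_mul,
      Pi.single_apply] at this
      simpa [hij] using this
    have h1 := horth i j hij
    have h2 := horth i k hik
    have h3 := horth j k hjk
    -- Eliminate `y j` and `y k` from the three orthogonality relations.
    have : x j * x k * (x i ^ 2 + y i ^ 2) = 0 := by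
      linear_combination x i * x k * h1 - y i * y j * h2 + y i ^ 2 * h3
    have hpos : 0 < x i ^ 2 + y i ^ 2 := by have := hx i; positivity
    exact mul_ne_zero (mul_ne_zero (hx j) (hx k)) hpos.ne' this

/-- No matrix of the pattern satisfies a cubic: the coefficient `c₁` in `A³ = c₂ A² + c₁ A + c₀` would
be both positive and nonpositive after shifting a diagonal entry on `β` to `0`. -/
theorem four_le_minDistinctEigenvalues_leafedConeGraph
    (hα : 2 < Fintype.card α) (hβ : 1 < Fintype.card β) :
    4 ≤ minDistinctEigenvalues (leafedConeGraph α β) := by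
  by_contra! hlt
  obtain ⟨b, b', hbb⟩ := Fintype.one_lt_card_iff.1 hβ
  obtain ⟨A, hA, hq⟩ := (minDistinctEigenvalues_isLeast (leafedConeGraph α β)).1
  obtain ⟨P, hP, hPd, hPA⟩ := exists_monic_aeval_sub_smul_one_eq_zero hA.1
    (hq.trans_le (Nat.le_of_lt_succ hlt)) (A (.inr (some b)) (.inr (some b)))
  obtain ⟨e, x, y, d, p, U, W, z, hx, hy, hp, hz, hAeq⟩ :=
    exists_eq_leafedConeMatrix (sub_smul_one_mem_symmetricMatricesOf hA
      (A (.inr (some b)) (.inr (some b))))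
  have hdb : d b = 0 := by
    simpa [leafedConeMatrix] using (congrFun₂ hAeq (.inr (some b)) (.inr (some b))).symm
  rw [hAeq] at hPA
  obtain ⟨c₀, c₁, c₂, hrel⟩ := aeval_mulVec_of_natDegree_eq_three hP hPd hPA
  -- The needed entries of the cubic relation: `hbu` is the one in column `b` and row `u`, and so on.
  have hbu := congrFun (hrel (Pi.single (.inr (some b)) 1)) (.inl none)
  have hb'u := congrFun (hrel (Pi.single (.inr (some b')) 1)) (.inl none)
  have hb'b := congrFun (hrel (Pi.single (.inr (some b)) 1)) (.inr (some b'))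
  have hbw := congrFun (hrel (Pi.single (.inr (some b)) 1)) (.inr none)
  have hba := fun i => congrFun (hrel (Pi.single (.inr (some b)) 1)) (.inl (some i))
  have haa := fun i j (hij : i ≠ j) => congrFun (hrel (Pi.single (.inl (some j)) 1)) (.inl (some i))
  have hua := fun i => congrFun (hrel (Pi.single (.inl none) 1)) (.inl (some i))
  simp only [leafedConeMatrix_mulVec_inl_some, leafedConeMatrix_mulVec_inl_none,
      leafedConeMatrix_mulVec_inr_some, leafedConeMatrix_mulVec_inr_none, Pi.add_apply,
      Pi.smul_apply, smul_eq_mul, Pi.single_apply] at hbu hb'b hb'u hbw hba haa hua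
  simp +contextual [hdb, hbb.symm] at hbu hb'b hb'u hbw hba haa hua
  have hcomm : ∑ i, y i * x i = ∑ i, x i * y i := Finset.sum_congr rfl fun i _ => mul_comm _ _
  simp only [← mul_assoc, ← Finset.sum_mul] at hbu hb'u hbw
  rw [hcomm] at hua
  have hd : d b' + W = c₂ :=
    mul_left_cancel₀ (mul_ne_zero (hp b') (hp b)) (by linear_combination hb'b)
  have hS : ∑ i, x i * y i + U * z = 0 := by
    refine (mul_eq_zero.1 ?_).resolve_right (hp b')
    linear_combination hb'u - z * p b' * hd
  obtain rfl : W = c₂ :=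
    mul_left_cancel₀ (mul_ne_zero hz (hp b)) (by linear_combination hbu - p b * hS)
  have hey : ∀ i, e i * y i + x i * z = 0 := fun i =>
    (mul_eq_zero.1 (by linear_combination hba i)).resolve_right (hp b)
  -- Row `w` exhibits `c₁` as a positive number, and `hc₁'` below as a nonpositive one.
  have hc₁ : ∑ i, y i * y i + z * z + ∑ i, p i * p i = c₁ :=
    mul_right_cancel₀ (hp b) (by linear_combination hbw)
  have hee : ∀ i j, i ≠ j → e i + e j + U = W := fun i j hij => by
    refine mul_left_cancel₀ (mul_ne_zero (hx i) (hx j)) ?_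
    linear_combination haa i j hij - y j * hey i - y i * hey j
  -- Compare `hee` for `i` and `j` with a common third index.
  have hconst : ∀ i j, e i = e j := fun i j => by
    obtain ⟨k, -, hk⟩ := Finset.exists_mem_notMem_of_card_lt_card
      (Finset.card_le_two.trans_lt hα : ({i, j} : Finset α).card < Finset.univ.card)
    simp only [Finset.mem_insert, Finset.mem_singleton, not_or] at hk
    linear_combination hee i k (Ne.symm hk.1) - hee j k (Ne.symm hk.2)
  obtain ⟨i, j, -, hij, -⟩ := Fintype.two_lt_card_iff.1 hα
  have hX : ∑ i, x i * x i = e i * U := by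
    refine mul_right_cancel₀ hz ?_
    have : (∑ j, x j * x j) * z + e i * ∑ j, x j * y j = 0 := by
      rw [Finset.sum_mul, Finset.mul_sum, ← Finset.sum_add_distrib]
      refine Finset.sum_eq_zero fun j _ => ?_
      rw [hconst i j]
      linear_combination x j * hey j
    linear_combination this - e i * hS
  have hc₁' : c₁ = -(e i ^ 2 + ∑ i, x i * x i) := by
    refine mul_left_cancel₀ (hx i) ?_
    have hW := hee i j hij
    rw [← hconst i j] at hW
    linear_combination -hua i + x i * 2 * hX + z * hey i + y i * hS + x i * (e i + U) * hW
  have hx0 : 0 ≤ ∑ i, x i * x i := Finset.sum_nonneg fun i _ => mul_self_nonneg _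
  have hy0 : 0 ≤ ∑ i, y i * y i := Finset.sum_nonneg fun i _ => mul_self_nonneg _
  have hp0 : 0 ≤ ∑ i, p i * p i := Finset.sum_nonneg fun i _ => mul_self_nonneg _
  have hz0 : 0 < z * z := mul_self_pos.2 hz
  linarith [sq_nonneg (e i)]
end

/-! ### The minimum number of distinct eigenvalues -/

theorem theorem6p5 {V : Type*} [Fintype V] (G : SimpleGraph V) (k₁ k₂ : ℕ)
    (hk₁ : 1 ≤ k₁) (hn : 5 ≤ Fintype.card V)
    (hG : Nonempty (G ≃g thresholdGraph (traceTwoSequence k₁ k₂))) :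
    ((k₁ = 1 ∨ k₁ = 2 ∨ k₂ = 0 ∨ k₂ = 1) → minDistinctEigenvalues G = 3) ∧
    (¬ (k₁ = 1 ∨ k₁ = 2 ∨ k₂ = 0 ∨ k₂ = 1) → minDistinctEigenvalues G = 4) := by
  obtain ⟨f⟩ := hG
  rw [Fintype.card_congr f.toEquiv, Fintype.card_fin, length_traceTwoSequence] at hn
  rw [minDistinctEigenvalues_congr (f.trans (leafedConeIso k₁ k₂).symm)]
  have : NeZero k₁ := ⟨by omega⟩
  refine ⟨fun h => le_antisymm ?_ ?_, fun h => ?_⟩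
  · rcases Nat.eq_zero_or_pos k₂ with rfl | hk₂
    · exact minDistinctEigenvalues_leafedConeGraph_le_of_isEmpty
    have : NeZero k₂ := ⟨hk₂.ne'⟩
    rcases h with rfl | rfl | rfl | rfl
    · exact minDistinctEigenvalues_leafedConeGraph_le_of_unique_left
    · exact minDistinctEigenvalues_leafedConeGraph_fin_two_le
    · exact absurd hk₂ (lt_irrefl 0)
    · exact minDistinctEigenvalues_leafedConeGraph_le_of_unique_right
  · refine three_le_minDistinctEigenvalues_leafedConeGraph ?_
    rcases Nat.eq_zero_or_pos k₂ with rfl | hk₂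
    · exact .inr (by rw [Fintype.card_fin]; omega)
    · exact .inl ⟨⟨0, hk₂⟩⟩
  · have : NeZero k₂ := ⟨by omega⟩
    exact minDistinctEigenvalues_leafedConeGraph_le_four.antisymm
      (four_le_minDistinctEigenvalues_leafedConeGraph (by rw [Fintype.card_fin]; omega)
        (by rw [Fintype.card_fin]; omega))
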